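/- A finite group $G$ is called a Roquette group if every normal abelian subgroup of $G$ is cyclic. For a subgroup $T$ of $G$ and $g\in G$ write ${}^gT=gTg^{-1}$; for subgroups $H\le N$ of $G$, the $N$-core of $H$ is the largest normal subgroup of $N$ contained in $H$. A subgroup $T$ of $G$ is called expansive in $G$ if, for every $g\in G$ with $g\notin N_G(T)$, the $N_G(T)$-core of the subgroup $\big({}^gT\cap N_G(T)\big)T$ properly contains $T$. Theorem. Let $p$ be a prime number and let $P$ be a Roquette $p$-group, that is, a finite $p$-group which is a Roquette group. Then $P$ has no non-trivial expansive subgroup with trivial $P$-core: there is no subgroup $T\neq 1$ of $P$ that is expansive in $P$ and whose $P$-core is trivial. -/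

import Mathlib

open scoped Pointwise

/-- A group is a *Roquette group* if all its normal abelian subgroups are cyclic
(used for finite groups). -/
def IsRoquetteGroup (G : Type*) [Group G] : Prop :=
  ∀ A : Subgroup G, A.Normal → IsMulCommutative A → IsCyclic A

/-- For subgroups `H ≤ N` of `G`, the `N`-core of `H`: the largest normal subgroup of `N`
contained in `H`, regarded as a subgroup of `G`. -/
def Subgroup.coreIn {G : Type*} [Group G] (N H : Subgroup G) : Subgroup G :=
  (H.subgroupOf N).normalCore.map N.subtype

/-- The subgroup `(ᵍT ∩ N_G(T)) T` of `G`, where `ᵍT = g T g⁻¹`. As a set it is the product of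
`ᵍT ∩ N_G(T)` and `T`, see `Subgroup.coe_expansiveProduct`. -/
def Subgroup.expansiveProduct {G : Type*} [Group G] (T : Subgroup G) (g : G) : Subgroup G :=
  (MulAut.conj g • T ⊓ Subgroup.normalizer (T : Set G)) ⊔ T

/-- The join in `Subgroup.expansiveProduct` is the product of sets. -/
theorem Subgroup.coe_expansiveProduct {G : Type*} [Group G] (T : Subgroup G) (g : G) :
    (T.expansiveProduct g : Set G) =
      ((MulAut.conj g • T ⊓ Subgroup.normalizer (T : Set G) : Subgroup G) : Set G) * (T : Set G) :=
  Subgroup.coe_mul_of_left_le_normalizer_right _ _ inf_le_right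

/-- `T.expansiveProduct g` lies in `N_G(T)`, so that its `N_G(T)`-core makes sense. -/
theorem Subgroup.expansiveProduct_le_normalizer {G : Type*} [Group G] (T : Subgroup G) (g : G) :
    T.expansiveProduct g ≤ Subgroup.normalizer (T : Set G) :=
  sup_le inf_le_right Subgroup.le_normalizer

/-- A subgroup `T` of `G` is *expansive* in `G` if for every `g ∉ N_G(T)`, the `N_G(T)`-core of
`(ᵍT ∩ N_G(T)) T` properly contains `T`. -/
def Subgroup.IsExpansive {G : Type*} [Group G] (T : Subgroup G) : Prop :=
  ∀ g : G, g ∉ Subgroup.normalizer (T : Set G) →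
    T < Subgroup.coreIn (Subgroup.normalizer (T : Set G)) (T.expansiveProduct g)

/-!
Let `A` be a maximal normal abelian subgroup of the Roquette `p`-group `P`.  It is its own
centralizer, and it is cyclic, say `A = ⟨a⟩`.  Every subgroup of `A` is normal in `P`, so a subgroup
`T` with trivial core satisfies `T ∩ A = 1`.  If `T ≠ 1`, then `a` does not normalize `T`, and it is
shown that `ᵃT ∩ N_P(T) = 1`; thus `(ᵃT ∩ N_P(T)) T = T`, and `T` is not expansive.

Suppose that `s ∈ T` is non-trivial and `a s a⁻¹` normalizes `T`.  Then `[a, s]` lies in `A` and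
normalizes `T`, hence it commutes with `s`.  If `s` acts on `A` by `x ↦ x ^ k`, this says that
`|A|` divides `(k - 1) ^ 2`, a property inherited by a power of `s` of order `p`.  Such elements do
not exist by `IsRoquetteGroup.not_dvd_sq_of_pow_eq_one`: the conjugates of an element `s` of order
`p` with this property have the form `c * s` with `c ∈ A` and `c ^ p = 1`
(`conj_mul_inv_pow_eq_one`), so that the normal closure of `s` is abelian, but not cyclic.
-/

/-! ### Self-centralizing normal subgroups of `p`-groups -/

theorem IsPGroup.exists_mem_center_of_normal {p : ℕ} [Fact p.Prime] {P : Type*} [Group P]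
    [Finite P] (hp : IsPGroup p P) {N : Subgroup P} (hN : N.Normal) (hne : N ≠ ⊥) :
    ∃ q ∈ N, q ∈ Subgroup.center P ∧ q ≠ 1 := by
  have hdvd : p ∣ Nat.card N := (hp.to_subgroup N).card_eq_or_dvd.resolve_left
    (mt Subgroup.card_eq_one.1 hne)
  obtain ⟨b, hb, h1⟩ := (hp.of_equiv ConjAct.toConjAct)
    |>.exists_fixed_point_of_prime_dvd_card_of_fixed_point N hdvd (a := 1) fun g => smul_one g
  refine ⟨b, b.2, Subgroup.mem_center_iff.2 fun g => ?_, fun h => h1 (Subtype.ext h.symm)⟩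
  have h := congrArg Subtype.val (hb (ConjAct.toConjAct g))
  change g * b * g⁻¹ = b at h
  exact mul_inv_eq_iff_eq_mul.1 h

/-- A maximal normal abelian subgroup of a finite `p`-group is its own centralizer. -/
theorem IsPGroup.exists_normal_isMulCommutative_centralizer_le {p : ℕ} [Fact p.Prime]
    {P : Type*} [Group P] [Finite P] (hp : IsPGroup p P) :
    ∃ A : Subgroup P, A.Normal ∧ IsMulCommutative A ∧ Subgroup.centralizer (A : Set P) ≤ A := by
  obtain ⟨A, hA⟩ := (Set.toFinite {A : Subgroup P | A.Normal ∧ IsMulCommutative A}).exists_maximal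
    ⟨⊥, inferInstance, inferInstance⟩
  obtain ⟨⟨hn, hc⟩, hmax⟩ := hA
  refine ⟨A, hn, hc, ?_⟩
  by_contra hle
  -- The image of the centralizer in `P ⧸ A` is a non-trivial normal subgroup, so it meets the
  -- center; a preimage of a central element extends `A` to a larger normal abelian subgroup.
  set C := (Subgroup.centralizer (A : Set P)).map (QuotientGroup.mk' A) with hC
  have hCn : C.Normal := Subgroup.Normal.map inferInstance _ (QuotientGroup.mk'_surjective A)
  have hCne : C ≠ ⊥ := by
    rwa [hC, Ne, Subgroup.map_eq_bot_iff, QuotientGroup.ker_mk']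
  obtain ⟨q, hqC, hqZ, hq⟩ := (hp.to_quotient A).exists_mem_center_of_normal hCn hCne
  obtain ⟨x, hxC, rfl⟩ := hqC
  have hxA : x ∉ A := fun h => hq ((QuotientGroup.eq_one_iff x).2 h)
  have hxc : ∀ g : P, g * x * g⁻¹ * x⁻¹ ∈ A := by
    intro g
    rw [← QuotientGroup.eq_one_iff]
    have := Subgroup.mem_center_iff.1 hqZ (g : P ⧸ A)
    simp only [QuotientGroup.mk'_apply] at this
    simp [this]
  have hcomm : ∀ u ∈ A, ∀ v ∈ A, u * v = v * u := fun u hu v hv => by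
    simpa using congrArg Subtype.val (hc.is_comm.comm ⟨u, hu⟩ ⟨v, hv⟩)
  have hB : Subgroup.closure (insert x (A : Set P)) ≤ A := by
    refine hmax ⟨?_, ?_⟩ (fun y hy => Subgroup.subset_closure (Or.inr hy))
    · refine ⟨fun y hy g => ?_⟩
      have hx : x ∈ Subgroup.closure (insert x (A : Set P)) := Subgroup.subset_closure (Or.inl rfl)
      induction hy using Subgroup.closure_induction with
      | mem y hy =>
        rcases hy with rfl | hy
        · have h : g * y * g⁻¹ * y⁻¹ ∈ Subgroup.closure (insert y (A : Set P)) :=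
            Subgroup.subset_closure (Or.inr (hxc g))
          simpa using Subgroup.mul_mem _ h hx
        · exact Subgroup.subset_closure (Or.inr (hn.conj_mem y hy g))
      | one => simp
      | mul y z _ _ h1 h2 => simpa [mul_assoc] using Subgroup.mul_mem _ h1 h2
      | inv y _ h => simpa [mul_assoc] using Subgroup.inv_mem _ h
    · refine Subgroup.isMulCommutative_closure ?_
      rintro u (rfl | hu) v (rfl | hv)
      · rfl
      · exact (Subgroup.mem_centralizer_iff.1 hxC v hv).symm
      · exact Subgroup.mem_centralizer_iff.1 hxC u hu
      · exact hcomm u hu v hv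
  exact hxA (hB (Subgroup.subset_closure (Or.inl rfl)))

/-! ### Congruences modulo `(k - 1) ^ 2` -/

theorem sub_one_sq_dvd_pow_sub (k : ℤ) (j : ℕ) : (k - 1) ^ 2 ∣ k ^ j - 1 - j * (k - 1) := by
  induction j with
  | zero => simp
  | succ j ih =>
    obtain ⟨c, hc⟩ := ih
    refine ⟨k * c + j, ?_⟩
    push_cast
    linear_combination k * hc

/-- The sum `1 + k + ⋯ + k ^ (j - 1)` is `j + j (j - 1) / 2 * (k - 1)` modulo `(k - 1) ^ 2`; both
sides are doubled to avoid the division. -/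
theorem sub_one_sq_dvd_two_mul_geom_sum_sub (k : ℤ) (j : ℕ) :
    (k - 1) ^ 2 ∣ 2 * ∑ i ∈ Finset.range j, k ^ i - 2 * j - j * (j - 1) * (k - 1) := by
  induction j with
  | zero => simp
  | succ j ih =>
    rw [Finset.sum_range_succ]
    have h := dvd_add ih ((sub_one_sq_dvd_pow_sub k j).mul_left 2)
    refine h.trans (dvd_of_eq ?_)
    push_cast
    ring

/-! ### Conjugation on a cyclic normal subgroup -/

section Conjugation

variable {G : Type*} [Group G]

theorem conj_zpow_of_conj_eq_zpow {a s : G} {k : ℤ} (h : s * a * s⁻¹ = a ^ k) {b : G}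
    (hb : b ∈ Subgroup.zpowers a) : s * b * s⁻¹ = b ^ k := by
  obtain ⟨j, rfl⟩ := hb
  dsimp only
  rw [← conj_zpow, h, ← zpow_mul, ← zpow_mul, mul_comm]

theorem pow_conj_eq_zpow_pow {a s : G} {k : ℤ} (h : s * a * s⁻¹ = a ^ k) (j : ℕ) :
    s ^ j * a * (s ^ j)⁻¹ = a ^ (k ^ j) := by
  induction j with
  | zero => simp
  | succ j ih =>
    calc s ^ (j + 1) * a * (s ^ (j + 1))⁻¹ = s * (s ^ j * a * (s ^ j)⁻¹) * s⁻¹ := by group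
      _ = a ^ (k ^ (j + 1)) := by
        rw [ih, conj_zpow_of_conj_eq_zpow h ⟨_, rfl⟩, ← zpow_mul, pow_succ]

theorem mul_pow_eq_zpow_geom_sum_mul_pow {a s : G} {k : ℤ} (h : s * a * s⁻¹ = a ^ k) {c : G}
    (hc : c ∈ Subgroup.zpowers a) (j : ℕ) :
    (c * s) ^ j = c ^ (∑ i ∈ Finset.range j, k ^ i) * s ^ j := by
  have h' := conj_zpow_of_conj_eq_zpow h hc
  induction j with
  | zero => simp
  | succ j ih =>
    rw [pow_succ', ih, Finset.sum_range_succ', pow_zero, add_comm, zpow_add, zpow_one, pow_succ' s]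
    have : s * c ^ (∑ i ∈ Finset.range j, k ^ i) = c ^ (∑ i ∈ Finset.range j, k ^ (i + 1)) * s := by
      rw [← mul_inv_eq_iff_eq_mul, ← conj_zpow, h', ← zpow_mul, Finset.mul_sum]
      simp only [pow_succ']
    simp only [mul_assoc]
    rw [← mul_assoc s, this, mul_assoc]

/-- Conjugations by two elements commute on a cyclic normal subgroup. -/
theorem conj_mul_inv_mem_centralizer {a : G} (hn : (Subgroup.zpowers a).Normal) (g s : G) :
    g * s * g⁻¹ * s⁻¹ ∈ Subgroup.centralizer (Subgroup.zpowers a : Set G) := by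
  obtain ⟨k, hk : a ^ k = _⟩ := hn.conj_mem a (Subgroup.mem_zpowers a) s
  obtain ⟨l, hl : a ^ l = _⟩ := hn.conj_mem a (Subgroup.mem_zpowers a) g
  rw [Subgroup.mem_centralizer_iff]
  intro x hx
  have hy : (s * g)⁻¹ * x * (s * g) ∈ Subgroup.zpowers a := by
    simpa using hn.conj_mem x hx (s * g)⁻¹
  set y := (s * g)⁻¹ * x * (s * g) with hy_def
  have hxy : x = s * g * y * (s * g)⁻¹ := by rw [hy_def]; group
  have h1 : g * (s * y * s⁻¹) * g⁻¹ = s * (g * y * g⁻¹) * s⁻¹ := by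
    rw [conj_zpow_of_conj_eq_zpow hk.symm hy, conj_zpow_of_conj_eq_zpow hl.symm hy,
      conj_zpow_of_conj_eq_zpow hl.symm (Subgroup.zpow_mem _ hy _),
      conj_zpow_of_conj_eq_zpow hk.symm (Subgroup.zpow_mem _ hy _), ← zpow_mul, ← zpow_mul,
      mul_comm]
  calc x * (g * s * g⁻¹ * s⁻¹) = s * (g * y * g⁻¹) * s⁻¹ * (g * s * g⁻¹ * s⁻¹) := by
        rw [hxy]; group
    _ = g * (s * y * s⁻¹) * g⁻¹ * (g * s * g⁻¹ * s⁻¹) := by rw [h1]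
    _ = g * s * g⁻¹ * s⁻¹ * x := by rw [hxy]; group

theorem mem_centralizer_zpowers {a h : G} (hh : h * a * h⁻¹ = a) :
    h ∈ Subgroup.centralizer (Subgroup.zpowers a : Set G) := by
  rw [Subgroup.mem_centralizer_iff]
  intro x hx
  have := conj_zpow_of_conj_eq_zpow (k := 1) (by rwa [zpow_one]) hx
  rw [zpow_one] at this
  exact (mul_inv_eq_iff_eq_mul.1 this).symm

theorem zpow_eq_one_of_mem_zpowers_of_dvd {a c : G} (hc : c ∈ Subgroup.zpowers a) {m : ℤ}
    (hm : (orderOf a : ℤ) ∣ m) : c ^ m = 1 :=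
  orderOf_dvd_iff_zpow_eq_one.1
    ((Int.natCast_dvd_natCast.2 (orderOf_dvd_of_mem_zpowers hc)).trans hm)

/-- This holds because `1 = k ^ p = 1 + p (k - 1)` modulo the order of `a`. -/
theorem orderOf_dvd_mul_sub_one {a s : G} {p : ℕ} (hs : s ^ p = 1) {k : ℤ} (hk : s * a * s⁻¹ = a ^ k)
    (hd : (orderOf a : ℤ) ∣ (k - 1) ^ 2) : (orderOf a : ℤ) ∣ p * (k - 1) := by
  have h := pow_conj_eq_zpow_pow hk p
  have h1 : (orderOf a : ℤ) ∣ k ^ p - 1 := by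
    rw [orderOf_dvd_iff_zpow_eq_one, zpow_sub_one, ← h, hs]
    simp
  simpa using dvd_sub h1 (hd.trans (sub_one_sq_dvd_pow_sub k p))

/-- A cyclic group contains at most one subgroup of order `p`. -/
theorem IsCyclic.mem_zpowers_of_pow_eq_one [Finite G] [IsCyclic G] {p : ℕ} {c s : G}
    (hc : orderOf c = p) (hs : s ^ p = 1) : s ∈ Subgroup.zpowers c := by
  classical
  have := Fintype.ofFinite G
  have hsub : (Subgroup.zpowers c : Set G).toFinset ⊆ Finset.univ.filter fun x : G => x ^ p = 1 := by
    intro x hx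
    rw [Set.mem_toFinset] at hx
    refine Finset.mem_filter.2 ⟨Finset.mem_univ _, orderOf_dvd_iff_pow_eq_one.1 ?_⟩
    exact hc ▸ orderOf_dvd_of_mem_zpowers hx
  have hcard : (Finset.univ.filter fun x : G => x ^ p = 1).card ≤
      (Subgroup.zpowers c : Set G).toFinset.card := by
    refine (IsCyclic.card_pow_eq_one_le (hc ▸ orderOf_pos c)).trans ?_
    rw [Set.toFinset_card, ← Nat.card_eq_fintype_card]
    exact hc ▸ (Nat.card_zpowers c).ge
  have hmem : s ∈ Finset.univ.filter fun x : G => x ^ p = 1 := by simpa using hs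
  rw [← Finset.eq_of_subset_of_card_le hsub hcard, Set.mem_toFinset] at hmem
  exact hmem

end Conjugation

/-! ### Elements of order `p` acting almost trivially -/

section

variable {p : ℕ} [Fact p.Prime] {P : Type*} [Group P]

theorem IsPGroup.pow_eq_one_of_zpow_mul_eq_one (hp : IsPGroup p P) {c : P} {m : ℤ}
    (hm : ¬ (p : ℤ) ∣ m) (h : c ^ (p * m) = 1) : c ^ p = 1 := by
  obtain ⟨n, hn⟩ := hp (c ^ p)
  have hcop : IsCoprime ((p : ℤ) ^ n) m :=
    ((Nat.prime_iff_prime_int.1 Fact.out).coprime_iff_not_dvd.2 hm).pow_left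
  obtain ⟨u, v, huv⟩ := hcop
  have h1 : (c ^ p) ^ m = 1 := by rwa [← zpow_natCast, ← zpow_mul]
  have h2 : (c ^ p) ^ ((p : ℤ) ^ n) = 1 := by exact_mod_cast hn
  calc c ^ p = (c ^ p) ^ (u * (p : ℤ) ^ n + v * m) := by rw [huv, zpow_one]
    _ = 1 := by
      rw [zpow_add, mul_comm u, mul_comm v, zpow_mul, zpow_mul, h1, h2, one_zpow, one_zpow, one_mul]

theorem IsPGroup.prime_dvd_sub_one (hp : IsPGroup p P) {a : P} (ha : a ≠ 1) {k : ℤ}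
    (hd : (orderOf a : ℤ) ∣ (k - 1) ^ 2) : (p : ℤ) ∣ k - 1 :=
  (Nat.prime_iff_prime_int.1 Fact.out).dvd_of_dvd_pow
    ((Int.natCast_dvd_natCast.2 (hp.dvd_orderOf ha)).trans hd)

/-- If an element `s` of order `p` acts on the self-centralizing cyclic normal subgroup `⟨a⟩` by
`k` with `(k - 1) ^ 2 ≡ 0`, then every conjugate of `s` is `c * s` with `c ^ p = 1`.
In general this comes from expanding `(c * s) ^ p = 1`; the exception is `p = 2` and `a ^ 4 = 1`, in
which case `P` is generated by `a` and `s`. -/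
theorem conj_mul_inv_pow_eq_one (hp : IsPGroup p P) {a s : P}
    (hn : (Subgroup.zpowers a).Normal)
    (hcent : Subgroup.centralizer (Subgroup.zpowers a : Set P) ≤ Subgroup.zpowers a)
    (hs : s ^ p = 1) (hsa : s ∉ Subgroup.zpowers a) {k : ℤ} (hk : s * a * s⁻¹ = a ^ k)
    (hd : (orderOf a : ℤ) ∣ (k - 1) ^ 2) (g : P) :
    (g * s * g⁻¹ * s⁻¹) ^ p = 1 := by
  have hsa' : ¬ s * a * s⁻¹ = a := fun h => hsa (hcent (mem_centralizer_zpowers h))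
  have hpd := orderOf_dvd_mul_sub_one hs hk hd
  obtain ⟨e, he⟩ : (p : ℤ) ∣ k - 1 := hp.prime_dvd_sub_one (fun h => hsa' (by simp [h])) hd
  set c := g * s * g⁻¹ * s⁻¹ with hc_def
  have hc : c ∈ Subgroup.zpowers a := hcent (conj_mul_inv_mem_centralizer hn g s)
  have hsum : c ^ (∑ i ∈ Finset.range p, k ^ i) = 1 := by
    have h : (c * s) ^ p = 1 := by
      rw [hc_def, inv_mul_cancel_right, conj_pow, hs, mul_one, mul_inv_cancel]
    rwa [mul_pow_eq_zpow_geom_sum_mul_pow hk hc, hs, mul_one] at h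
  rcases (Fact.out : p.Prime).eq_two_or_odd' with rfl | hodd
  · have hc2 : c ^ (2 + (k - 1)) = 1 := by
      rw [← hsum]
      congr 1
      simp [Finset.sum_range_succ]
      ring
    by_cases h2e : (2 : ℤ) ∣ e
    · -- Here `k - 1` is divisible by `4`, so that `2 + (k - 1)` is twice an odd number.
      refine hp.pow_eq_one_of_zpow_mul_eq_one (m := 1 + e) (by push_cast; omega) ?_
      rw [← hc2, he]
      congr 1
      push_cast
      ring
    · have h4 : (orderOf a : ℤ) ∣ 4 := by
        obtain ⟨n, hn⟩ := IsPGroup.iff_orderOf.1 hp a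
        have h3 : n ≤ 2 := by
          by_contra! h3
          have h8 : (8 : ℤ) ∣ orderOf a := by
            rw [hn]
            exact_mod_cast pow_dvd_pow 2 h3
          have := h8.trans hpd
          push_cast at this he
          omega
        rw [hn]
        exact_mod_cast pow_dvd_pow 2 h3
      -- Conjugation by an element of `⟨a⟩` changes `s` as claimed, and every element of `P` lies
      -- in `⟨a⟩` or in `⟨a⟩ * s⁻¹`, because it centralizes or inverts `a`.
      have key : ∀ h ∈ Subgroup.zpowers a, (h * s * h⁻¹ * s⁻¹) ^ 2 = 1 := by
        intro h hh
        have h1 : h * s * h⁻¹ * s⁻¹ = h ^ (-(k - 1)) := by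
          have h2 := conj_zpow_of_conj_eq_zpow hk hh
          calc h * s * h⁻¹ * s⁻¹ = h * (s * h * s⁻¹)⁻¹ := by group
            _ = h ^ (-(k - 1)) := by rw [h2, neg_sub, zpow_sub, zpow_one]
        rw [h1, ← zpow_natCast, ← zpow_mul]
        exact zpow_eq_one_of_mem_zpowers_of_dvd hh
          (hpd.trans ⟨-1, by ring⟩)
      obtain ⟨l, hl : a ^ l = _⟩ := hn.conj_mem a (Subgroup.mem_zpowers a) g
      have ha4 : ∀ m : ℤ, 4 ∣ m - 1 → a ^ m = a := by
        intro m hm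
        have := zpow_eq_one_of_mem_zpowers_of_dvd (Subgroup.mem_zpowers a) (h4.trans hm)
        rwa [zpow_sub_one, mul_inv_eq_one] at this
      push_cast at he
      obtain h | h | h : (2 : ℤ) ∣ l ∨ (4 : ℤ) ∣ l - 1 ∨ (4 : ℤ) ∣ l - 3 := by omega
      · -- An automorphism of `⟨a⟩` cannot map `a` to a square unless `a ^ 2 = 1`.
        exfalso
        have h2 : a ^ 2 = 1 := by
          have h5 : (a ^ l) ^ 2 = 1 := by
            rw [← zpow_natCast, ← zpow_mul]
            exact zpow_eq_one_of_mem_zpowers_of_dvd (Subgroup.mem_zpowers a)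
              (h4.trans (by push_cast; omega))
          rw [hl, conj_pow] at h5
          simpa using h5
        apply hsa'
        rw [hk, ← mul_inv_eq_one, ← zpow_sub_one, he, zpow_mul]
        have : a ^ (2 : ℤ) = 1 := by exact_mod_cast h2
        rw [this, one_zpow]
      · exact key g (hcent (mem_centralizer_zpowers (by rw [← hl, ha4 l h])))
      · have hgs : g * s ∈ Subgroup.zpowers a := by
          refine hcent (mem_centralizer_zpowers ?_)
          calc g * s * a * (g * s)⁻¹ = g * (s * a * s⁻¹) * g⁻¹ := by group
            _ = a ^ (l * k) := by
              rw [hk, conj_zpow_of_conj_eq_zpow hl.symm (Subgroup.zpow_mem _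
                (Subgroup.mem_zpowers a) _), ← zpow_mul, mul_comm]
            _ = a := by
              apply ha4
              obtain ⟨u, hu⟩ := h
              obtain ⟨v, hv⟩ : (2 : ℤ) ∣ e - 1 := by omega
              refine ⟨u * k + 3 * v + 2, ?_⟩
              linear_combination k * hu + 3 * he + 6 * hv
        have := key (g * s) hgs
        rwa [show g * s * s * (g * s)⁻¹ * s⁻¹ = c by rw [hc_def]; group] at this
  · -- For odd `p`, the sum in `hsum` is congruent to `p` modulo the order of `a`, up to the factor `2`.
    have h2p : c ^ ((p : ℤ) * 2) = 1 := by
      have h1 : (orderOf a : ℤ) ∣ 2 * ∑ i ∈ Finset.range p, k ^ i - 2 * p := by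
        have := dvd_add (hd.trans (sub_one_sq_dvd_two_mul_geom_sum_sub k p))
          (hpd.mul_left ((p : ℤ) - 1))
        refine this.trans (dvd_of_eq ?_)
        ring
      have h3 := zpow_eq_one_of_mem_zpowers_of_dvd hc h1
      rwa [zpow_sub, zpow_mul', hsum, one_zpow, one_mul, inv_eq_one, mul_comm] at h3
    refine hp.pow_eq_one_of_zpow_mul_eq_one (fun h => ?_) h2p
    have h2 : p ∣ 2 := by exact_mod_cast h
    rw [(Nat.prime_dvd_prime_iff_eq Fact.out Nat.prime_two).1 h2] at hodd
    exact absurd hodd (by decide)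

/-- In a Roquette group, no element `s` of order `p` acts by `k` with `(k - 1) ^ 2 ≡ 0` on a
self-centralizing cyclic normal subgroup `⟨a⟩`: the normal closure of `s` would be abelian, and it
would contain two subgroups of order `p`, generated by `s` and by `[a, s]`. -/
theorem IsRoquetteGroup.not_dvd_sq_of_pow_eq_one [Finite P] (hp : IsPGroup p P)
    (hR : IsRoquetteGroup P) {a s : P} (hn : (Subgroup.zpowers a).Normal)
    (hcent : Subgroup.centralizer (Subgroup.zpowers a : Set P) ≤ Subgroup.zpowers a)
    (hs : s ^ p = 1) (hsa : s ∉ Subgroup.zpowers a) {k : ℤ} (hk : s * a * s⁻¹ = a ^ k) :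
    ¬ (orderOf a : ℤ) ∣ (k - 1) ^ 2 := by
  intro hd
  have hsa' : ¬ s * a * s⁻¹ = a := fun h => hsa (hcent (mem_centralizer_zpowers h))
  obtain ⟨e, he⟩ : (p : ℤ) ∣ k - 1 := hp.prime_dvd_sub_one (fun h => hsa' (by simp [h])) hd
  have hpow := conj_mul_inv_pow_eq_one hp hn hcent hs hsa hk hd
  have hmem : ∀ g : P, g * s * g⁻¹ * s⁻¹ ∈ Subgroup.zpowers a := fun g =>
    hcent (conj_mul_inv_mem_centralizer hn g s)
  have hcs : ∀ g : P, Commute s (g * s * g⁻¹ * s⁻¹) := by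
    intro g
    have h := conj_zpow_of_conj_eq_zpow hk (hmem g)
    have hp1 := hpow g
    set c := g * s * g⁻¹ * s⁻¹
    have h1 : c ^ k = c := by
      rw [← mul_inv_eq_one, ← zpow_sub_one, he, zpow_mul, zpow_natCast, hp1, one_zpow]
    rw [h1] at h
    exact mul_inv_eq_iff_eq_mul.1 h
  -- The conjugates of `s` are the `c * s` with such `c`, so they commute with each other.
  have hcc : ∀ g h : P, Commute (g * s * g⁻¹ * s⁻¹) (h * s * h⁻¹ * s⁻¹) := by
    intro g h
    obtain ⟨i, hi : a ^ i = _⟩ := hmem g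
    obtain ⟨j, hj : a ^ j = _⟩ := hmem h
    rw [← hi, ← hj]
    exact Commute.zpow_zpow_self a i j
  have hV : IsMulCommutative (Subgroup.normalClosure {s}) := by
    refine Subgroup.isMulCommutative_closure ?_
    intro x hx y hy
    obtain ⟨_, rfl, hsx⟩ := Group.mem_conjugatesOfSet_iff.1 hx
    obtain ⟨_, rfl, hsy⟩ := Group.mem_conjugatesOfSet_iff.1 hy
    obtain ⟨g, rfl⟩ := isConj_iff.1 hsx
    obtain ⟨h, rfl⟩ := isConj_iff.1 hsy
    have := ((hcc g h).mul_left (hcs h)).mul_right ((hcs g).symm.mul_left (Commute.refl _))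
    simpa [Commute, SemiconjBy] using this
  have hcyc : IsCyclic (Subgroup.normalClosure {s}) := hR _ inferInstance hV
  have hsV : s ∈ Subgroup.normalClosure {s} := Subgroup.subset_normalClosure rfl
  have hcV : a * s * a⁻¹ * s⁻¹ ∈ Subgroup.normalClosure {s} :=
    Subgroup.mul_mem _ (Subgroup.normalClosure_normal.conj_mem s hsV a) (Subgroup.inv_mem _ hsV)
  have hc1 : a * s * a⁻¹ * s⁻¹ ≠ 1 := by
    intro h
    apply hsa'
    rw [mul_inv_eq_one, mul_inv_eq_iff_eq_mul] at h
    rw [← h, mul_inv_cancel_right]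
  have hord : orderOf (⟨_, hcV⟩ : Subgroup.normalClosure {s}) = p :=
    orderOf_eq_prime (Subtype.ext (hpow a)) fun h => hc1 (congrArg Subtype.val h)
  obtain ⟨i, hi⟩ := IsCyclic.mem_zpowers_of_pow_eq_one hord
    (s := (⟨s, hsV⟩ : Subgroup.normalClosure {s})) (Subtype.ext hs)
  have hi' : (a * s * a⁻¹ * s⁻¹) ^ i = s := congrArg Subtype.val hi
  exact hsa (hi' ▸ Subgroup.zpow_mem _ (hmem a) i)

end

/-! ### Expansive subgroups -/

/-- Every subgroup of a cyclic normal subgroup is normal, so a subgroup with trivial core meets the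
cyclic normal subgroup trivially. -/
theorem eq_one_of_mem_zpowers_of_normalCore_eq_bot {G : Type*} [Group G] {T : Subgroup G} {a : G}
    (hn : (Subgroup.zpowers a).Normal) (hT : T.normalCore = ⊥) {x : G} (hxT : x ∈ T)
    (hxa : x ∈ Subgroup.zpowers a) : x = 1 := by
  rw [← Subgroup.mem_bot, ← hT]
  intro g
  obtain ⟨l, hl : a ^ l = _⟩ := hn.conj_mem a (Subgroup.mem_zpowers a) g
  rw [conj_zpow_of_conj_eq_zpow hl.symm hxa]
  exact Subgroup.zpow_mem _ hxT l

theorem Subgroup.coreIn_le {G : Type*} [Group G] (N H : Subgroup G) : Subgroup.coreIn N H ≤ H := by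
  rintro _ ⟨x, hx, rfl⟩
  exact Subgroup.normalCore_le (H.subgroupOf N) hx

theorem mainTheorem1 (p : ℕ) [Fact p.Prime] (P : Type*) [Group P] [Finite P]
    (hp : IsPGroup p P) (hR : IsRoquetteGroup P) :
    ¬ ∃ T : Subgroup P, T ≠ ⊥ ∧ T.normalCore = ⊥ ∧ T.IsExpansive := by
  rintro ⟨T, hT, hcore, hexp⟩
  obtain ⟨A, hn, hc, hcent⟩ := hp.exists_normal_isMulCommutative_centralizer_le
  obtain ⟨a, rfl⟩ := (Subgroup.isCyclic_iff_exists_zpowers_eq_top A).1 (hR A hn hc)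
  have hTA : ∀ x ∈ T, x ∈ Subgroup.zpowers a → x = 1 := fun x hx hxa =>
    eq_one_of_mem_zpowers_of_normalCore_eq_bot hn hcore hx hxa
  have haN : a ∉ Subgroup.normalizer (T : Set P) := by
    intro haN
    refine hT ((Subgroup.eq_bot_iff_forall T).2 fun t ht => hTA t ht ?_)
    have h1 : a * t * a⁻¹ * t⁻¹ = 1 := hTA _
      (T.mul_mem ((Subgroup.mem_normalizer_iff.1 haN t).1 ht) (T.inv_mem ht))
      (hcent (conj_mul_inv_mem_centralizer hn a t))
    refine hcent (mem_centralizer_zpowers ?_)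
    rw [mul_inv_eq_one, mul_inv_eq_iff_eq_mul] at h1
    rw [← h1, mul_inv_cancel_right]
  refine (hexp a haN).not_ge ((Subgroup.coreIn_le _ _).trans (sup_le ?_ le_rfl))
  rintro _ ⟨⟨s, hsT, rfl⟩, hxN⟩
  change s ∈ T at hsT
  change a * s * a⁻¹ ∈ Subgroup.normalizer (T : Set P) at hxN
  change a * s * a⁻¹ ∈ T
  suffices h : s = 1 by simp [h]
  by_contra hs1
  have hcA : a * s * a⁻¹ * s⁻¹ ∈ Subgroup.zpowers a := hcent (conj_mul_inv_mem_centralizer hn a s)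
  set c := a * s * a⁻¹ * s⁻¹ with hc_def
  have hcN : c ∈ Subgroup.normalizer (T : Set P) :=
    Subgroup.mul_mem _ hxN (Subgroup.inv_mem _ (Subgroup.le_normalizer hsT))
  -- `[c, s]` lies in `T`, as `c` normalizes `T`, and in `⟨a⟩`, which is normal.
  have hcs : c * s * c⁻¹ * s⁻¹ = 1 := by
    refine hTA _ (T.mul_mem ((Subgroup.mem_normalizer_iff.1 hcN s).1 hsT) (T.inv_mem hsT)) ?_
    have h1 := Subgroup.mul_mem _ hcA (hn.conj_mem _ (Subgroup.inv_mem _ hcA) s)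
    simpa only [mul_assoc] using h1
  obtain ⟨k, hk : a ^ k = _⟩ := hn.conj_mem a (Subgroup.mem_zpowers a) s
  have hd : (orderOf a : ℤ) ∣ (k - 1) ^ 2 := by
    have h1 : c = a ^ (1 - k) := by
      rw [zpow_sub, zpow_one, hk, hc_def]
      group
    have h2 : s * c * s⁻¹ = c := by
      rw [mul_inv_eq_one, mul_inv_eq_iff_eq_mul] at hcs
      rw [← hcs, mul_inv_cancel_right]
    rw [conj_zpow_of_conj_eq_zpow hk.symm hcA, ← mul_inv_eq_one, ← zpow_sub_one, h1,
      ← zpow_mul] at h2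
    rw [← dvd_neg]
    exact (orderOf_dvd_iff_zpow_eq_one.2 h2).trans (dvd_of_eq (by ring))
  -- Replace `s` by a power of order `p`; its exponent is a power of `k`.
  set m := orderOf s / p with hm
  have hord : orderOf (s ^ m) = p :=
    orderOf_pow_orderOf_div (orderOf_pos s).ne' (hp.dvd_orderOf hs1)
  have hsm : s ^ m ∉ Subgroup.zpowers a := by
    intro h
    have h1 := hTA _ (T.pow_mem hsT m) h
    rw [h1, orderOf_one] at hord
    exact (Fact.out : p.Prime).one_lt.ne hord
  refine hR.not_dvd_sq_of_pow_eq_one hp hn hcent (hord ▸ pow_orderOf_eq_one (s ^ m)) hsm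
    (pow_conj_eq_zpow_pow hk.symm m) (hd.trans (pow_dvd_pow_of_dvd ?_ 2))
  simpa using sub_dvd_pow_sub_pow k 1 m
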